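/- Let $R$ be a commutative Noetherian local ring with maximal ideal $\mathfrak m$, let $\mathfrak a$ be an ideal of $R$, and let $N$ be a finitely generated $R$-module. For a finitely generated $R$-module $L$, let $\operatorname{depth}_R(\mathfrak a,L)$ be the common length of the maximal $L$-regular sequences in $\mathfrak a$ if $\mathfrak a L\neq L$, and set $\operatorname{depth}_R(\mathfrak a,L)=\infty$ if $\mathfrak a L=L$. Let $\Omega_R N$ denote the first syzygy of $N$, i.e. the image of the first differential in a minimal free resolution of $N$ (unique up to isomorphism). Assume that: 1. $\operatorname{depth}_R(\mathfrak a,R)\geq 1$; 2. $N$ is $2$-Tor-rigid, i.e. for every finitely generated $R$-module $X$ and every integer $t\geq 0$, if $\operatorname{Tor}^R_{t+1}(N,X)=\operatorname{Tor}^R_{t+2}(N,X)=0$, then $\operatorname{Tor}^R_i(N,X)=0$ for all $i\geq t+1$; 3. $N$ is generically free, i.e. $N_{\mathfrak p}$ is a free $R_{\mathfrak p}$-module for every associated prime $\mathfrak p$ of $R$ (equivalently, for every prime $\mathfrak p$ with $\operatorname{depth}R_{\mathfrak p}=0$). If $M=\Omega_R N\neq 0$, then $\operatorname{depth}_R(\mathfrak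 a,M)\leq \operatorname{depth}_R(\mathfrak a,R)+1$. Moreover, if $R$ is reduced, then every finitely generated $R$-module is generically free, so that condition 3 holds automatically. -/

import Mathlib

universe u v w

noncomputable section

open Classical in
/-- The `𝔞`-depth (grade of `𝔞` on `M`), with values in `ℕ∞`: it is `∞` if `𝔞 M = M`, and otherwise
the largest length of an `M`-regular sequence contained in `𝔞`. Over a Noetherian ring and for
finitely generated `M`, this is the common length of all maximal `M`-regular sequences in `𝔞`. -/
def idealDepth {R : Type u} [CommRing R] (𝔞 : Ideal R) (M : Type v) [AddCommGroup M] [Module R M] :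
    ℕ∞ :=
  if 𝔞 • (⊤ : Submodule R M) = ⊤ then ⊤
  else ⨆ (rs : List R) (_ : (∀ r ∈ rs, r ∈ 𝔞) ∧ RingTheory.Sequence.IsRegular M rs),
    (rs.length : ℕ∞)

/-- `M` is (isomorphic to) the first syzygy `Ω_R N` of `N` over the local ring `R`: the kernel of
a minimal free cover `R^n → N`, that is, of a surjection whose kernel lies in `𝔪 R^n`. This kernel
is the image of the first differential in a minimal free resolution of `N`. -/
def IsFirstSyzygy (R : Type u) [CommRing R] [IsLocalRing R]
    (N : Type v) [AddCommGroup N] [Module R N] (M : Type w) [AddCommGroup M] [Module R M] : Prop :=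
  ∃ (n : ℕ) (f : (Fin n → R) →ₗ[R] N), Function.Surjective f ∧
    LinearMap.ker f ≤ IsLocalRing.maximalIdeal R • (⊤ : Submodule R (Fin n → R)) ∧
    Nonempty (M ≃ₗ[R] LinearMap.ker f)

/-- `N` is `n`-Tor-rigid (for `n ≥ 1`): for every finitely generated `R`-module `X` and every
`t ≥ 0`, if `Tor_i^R(N, X) = 0` for `i = t + 1, …, t + n`, then `Tor_i^R(N, X) = 0` for all
`i ≥ t + 1`. -/
def IsTorRigid (R : Type u) [CommRing R] (n : ℕ) (N : Type u) [AddCommGroup N] [Module R N] :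
    Prop :=
  ∀ (X : Type u) [AddCommGroup X] [Module R X] [Module.Finite R X] (t : ℕ),
    (∀ i, t + 1 ≤ i → i ≤ t + n → CategoryTheory.Limits.IsZero
      (((CategoryTheory.Tor (ModuleCat.{u} R) i).obj (ModuleCat.of R N)).obj
        (ModuleCat.of R X))) →
    ∀ i, t + 1 ≤ i → CategoryTheory.Limits.IsZero
      (((CategoryTheory.Tor (ModuleCat.{u} R) i).obj (ModuleCat.of R N)).obj
        (ModuleCat.of R X))

/-- `N` is generically free: `N_𝔭` is a free `R_𝔭`-module for every associated prime `𝔭` of `R`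
(over a Noetherian ring: for every prime `𝔭` with `depth R_𝔭 = 0`). -/
def IsGenericallyFree (R : Type u) [CommRing R] (N : Type v) [AddCommGroup N] [Module R N] :
    Prop :=
  ∀ (𝔭 : Ideal R) [𝔭.IsPrime], 𝔭 ∈ associatedPrimes R R →
    Module.Free (Localization.AtPrime 𝔭) (LocalizedModule.AtPrime 𝔭 N)

end

/-!
The depth bound for first syzygies of `2`-Tor-rigid modules.

Let `0 → K → F → N → 0` be exact with `F = R^m`, and suppose that `𝔞` contains a `K`-regular sequence
of length `n + 2`. It is shown that `𝔞` then contains an `R`-regular sequence of length `n + 1`,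
which is the bound. The induction runs over finitely generated modules `A` with `Tor_i(N, A) = 0` for
`i = 1, 2, 3` (starting from `A = R`), the claim being that a regular sequence of length `n + 2` on
`K ⊗ A` yields one of length `n + 1` on `A` (`hasWeaklyRegularSeq_of_syzygy`). If `n > 0`, prime
avoidance gives `x ∈ 𝔞` regular on `A`, `N ⊗ A` and `K ⊗ A`; the hypotheses pass to `A / xA`, where
Rees' theorem supplies the regular sequence on `K ⊗ A / xA`.

Rigidity enters only for `n = 0` (`hasWeaklyRegularSeq_one_of_two`). Choose `v ∈ 𝔞` whose kernels
`Γ` on `A` and on `F ⊗ A` and `N ⊗ A` are exactly the `𝔞`-power torsion. As `K ⊗ A` has depth at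
least two, the torsion of `F ⊗ A` surjects onto that of `N ⊗ A`; this says
`Tor₁(N, A / vA) = 0`. As `v` is regular on `K ⊗ A`, also `Tor₂(N, A / vA) = 0`. Rigidity gives
`Tor₃(N, A / vA) = Tor₁(N, Γ) = 0`, so `K ⊗ Γ` embeds in `F ⊗ A`. Its image comes from elements of
`K ⊗ A` killed by `v`, hence `K ⊗ Γ = 0`, and `Γ = 0` by Nakayama: `v` is `A`-regular.

The vanishing of `Tor₁` is handled through the predicate `TorOneVanishes`, for which the pieces of the
long exact sequence that are needed are diagram chases; `isZero_tor_one_iff` and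
`isZero_tor_succ_succ_iff` compare it with the derived functors in Mathlib.

Over a reduced ring, the localization at an associated prime is a field, so every module is
generically free (`isGenericallyFree_of_isReduced`).
-/

open TensorProduct Function

/-! ### Vanishing of the first Tor by diagram chases -/

section TorOne

variable {R : Type u} [CommRing R]

/-- `TorOneVanishes N X` expresses `Tor₁(N, X) = 0` without resolutions: `N ⊗ -` keeps every short
exact sequence ending in `X` short exact. -/
def TorOneVanishes (N X : Type u) [AddCommGroup N] [Module R N] [AddCommGroup X] [Module R X] :
    Prop :=
  ∀ (A B : Type u) [AddCommGroup A] [Module R A] [AddCommGroup B] [Module R B]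
    (f : A →ₗ[R] B) (g : B →ₗ[R] X), Injective f → Exact f g → Surjective g →
    Injective (f.lTensor N)

variable {N L F X X' X'' : Type u} [AddCommGroup N] [Module R N] [AddCommGroup L] [Module R L]
  [AddCommGroup F] [Module R F] [AddCommGroup X] [Module R X] [AddCommGroup X'] [Module R X']
  [AddCommGroup X''] [Module R X'']

/-- One flat presentation of `N` suffices to detect `Tor₁(N, X) = 0`. With `symm`, this is the balance
of `Tor₁`. -/
theorem TorOneVanishes.of_rTensor_injective [Module.Flat R F] {j : L →ₗ[R] F} {q : F →ₗ[R] N}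
    (hjq : Exact j q) (hq : Surjective q) (h : Injective (j.rTensor X)) :
    TorOneVanishes (R := R) N X := by
  intro A B _ _ _ _ f g hf hfg hg
  exact lTensor_injective_of_exact_of_exact_of_rTensor_injective hjq hq hfg hg h
    (Module.Flat.lTensor_preserves_injective_linearMap f hf)

variable (R N) in
theorem exists_flat_presentation : ∃ (L F : Type u) (_ : AddCommGroup L) (_ : Module R L)
    (_ : AddCommGroup F) (_ : Module R F) (j : L →ₗ[R] F) (q : F →ₗ[R] N),
    Module.Flat R F ∧ Injective j ∧ Exact j q ∧ Surjective q :=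
  ⟨LinearMap.ker (Finsupp.linearCombination R (id : N → N)), N →₀ R, inferInstance, inferInstance,
    inferInstance, inferInstance, Submodule.subtype _, Finsupp.linearCombination R id,
    inferInstance, Submodule.subtype_injective _, LinearMap.exact_subtype_ker_map _,
    Finsupp.linearCombination_id_surjective R N⟩

theorem TorOneVanishes.symm (h : TorOneVanishes (R := R) N X) : TorOneVanishes (R := R) X N := by
  obtain ⟨L, F, _, _, _, _, j, q, _, hj, hjq, hq⟩ := exists_flat_presentation R X
  exact .of_rTensor_injective hjq hq ((LinearMap.lTensor_inj_iff_rTensor_inj _ _).1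
    (h _ _ j q hj hjq hq))

theorem TorOneVanishes.of_lTensor_injective [Module.Flat R F] {j : L →ₗ[R] F} {q : F →ₗ[R] X}
    (hjq : Exact j q) (hq : Surjective q) (h : Injective (j.lTensor N)) :
    TorOneVanishes (R := R) N X :=
  (of_rTensor_injective hjq hq ((LinearMap.lTensor_inj_iff_rTensor_inj _ _).1 h)).symm

theorem TorOneVanishes.rTensor_injective (h : TorOneVanishes (R := R) N X) {j : L →ₗ[R] F}
    {q : F →ₗ[R] N} (hj : Injective j) (hjq : Exact j q) (hq : Surjective q) :
    Injective (j.rTensor X) :=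
  (LinearMap.lTensor_inj_iff_rTensor_inj _ _).1 (h.symm _ _ j q hj hjq hq)

theorem TorOneVanishes.of_flat_right [Module.Flat R X] : TorOneVanishes (R := R) N X := by
  obtain ⟨L, F, _, _, _, _, j, q, _, hj, hjq, hq⟩ := exists_flat_presentation R N
  exact .of_rTensor_injective hjq hq (Module.Flat.rTensor_preserves_injective_linearMap _ hj)

theorem TorOneVanishes.congr (e : X ≃ₗ[R] X') (h : TorOneVanishes (R := R) N X) :
    TorOneVanishes (R := R) N X' := by
  intro A B _ _ _ _ f g hf hfg hg
  refine h A B f (e.symm.toLinearMap ∘ₗ g) hf (fun x ↦ ?_) (e.symm.surjective.comp hg)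
  simpa using hfg x

/-- Part of the long exact sequence `Tor₁(N, X) → Tor₁(N, X'') → N ⊗ X' → N ⊗ X`. -/
theorem TorOneVanishes.of_shortExact (h : TorOneVanishes (R := R) N X) {f : X' →ₗ[R] X}
    {g : X →ₗ[R] X''} (hfg : Exact f g) (hg : Surjective g) (hf : Injective (f.lTensor N)) :
    TorOneVanishes (R := R) N X'' := by
  obtain ⟨L, F, _, _, _, _, j, q, _, hj, hjq, hq⟩ := exists_flat_presentation R N
  refine .of_rTensor_injective hjq hq ((LinearMap.lTensor_inj_iff_rTensor_inj _ _).1 ?_)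
  exact lTensor_injective_of_exact_of_exact_of_rTensor_injective hfg hg hjq hq
    ((LinearMap.lTensor_inj_iff_rTensor_inj _ _).1 hf) (h.symm _ _ j q hj hjq hq)

/-- Dimension shifting: `Tor₂(N, X'') = Tor₁(L, X'')` for a syzygy `L` of `N`, and it agrees with
`Tor₁(N, X')` as soon as `Tor₁(N, X) = Tor₂(N, X) = 0`. -/
theorem TorOneVanishes.syzygy_iff [Module.Flat R F] {j : L →ₗ[R] F} {q : F →ₗ[R] N}
    (hj : Injective j) (hjq : Exact j q) (hq : Surjective q)
    (h₁ : TorOneVanishes (R := R) N X) (h₂ : TorOneVanishes (R := R) L X)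
    {f : X' →ₗ[R] X} {g : X →ₗ[R] X''} (hf : Injective f) (hfg : Exact f g) (hg : Surjective g) :
    TorOneVanishes (R := R) L X'' ↔ TorOneVanishes (R := R) N X' := by
  have hF : Injective (f.lTensor F) := Module.Flat.lTensor_preserves_injective_linearMap f hf
  have hX : Injective (j.rTensor X) := h₁.rTensor_injective hj hjq hq
  have comm : j.rTensor X ∘ f.lTensor L = f.lTensor F ∘ j.rTensor X' := by
    rw [← LinearMap.coe_comp, ← LinearMap.coe_comp, LinearMap.rTensor_comp_lTensor,
      LinearMap.lTensor_comp_rTensor]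
  constructor
  · intro h
    refine .of_rTensor_injective hjq hq (Injective.of_comp (f := f.lTensor F) ?_)
    rw [← comm]
    exact hX.comp (h _ _ f g hf hfg hg)
  · intro h
    refine h₂.of_shortExact hfg hg (Injective.of_comp (f := j.rTensor X) ?_)
    rw [comm]
    exact hF.comp (h.rTensor_injective hj hjq hq)

end TorOne

/-! ### Comparison with the derived functor Tor -/

section Exactness

variable {R : Type u} [CommRing R]
variable {N P₀ P₁ P₂ : Type u} [AddCommGroup N] [Module R N] [AddCommGroup P₀] [Module R P₀]
  [AddCommGroup P₁] [Module R P₁] [AddCommGroup P₂] [Module R P₂]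

theorem exact_liftQ_mkQ {d₀ : P₁ →ₗ[R] P₀} {d₁ : P₂ →ₗ[R] P₁} (h : Exact d₁ d₀) :
    Exact ((LinearMap.range d₁).liftQ d₀ (LinearMap.exact_iff.1 h).ge)
      (LinearMap.range d₀).mkQ := by
  rw [LinearMap.exact_iff, Submodule.ker_mkQ, Submodule.range_liftQ]

theorem liftQ_range_injective {d₀ : P₁ →ₗ[R] P₀} {d₁ : P₂ →ₗ[R] P₁} (h : Exact d₁ d₀) :
    Injective ((LinearMap.range d₁).liftQ d₀ (LinearMap.exact_iff.1 h).ge) := by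
  rw [← LinearMap.ker_eq_bot]
  exact Submodule.ker_liftQ_eq_bot _ _ _ (LinearMap.exact_iff.1 h).le

/-- The homology of `N ⊗ P` in the middle of an exact `P₂ → P₁ → P₀` with `P₀` flat is
`Tor₁(N, P₀ / im P₁)`. -/
theorem lTensor_exact_iff_torOneVanishes [Module.Flat R P₀] {d₀ : P₁ →ₗ[R] P₀}
    {d₁ : P₂ →ₗ[R] P₁} (h : Exact d₁ d₀) :
    Exact (d₁.lTensor N) (d₀.lTensor N) ↔
      TorOneVanishes (R := R) N (P₀ ⧸ LinearMap.range d₀) := by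
  set e := (LinearMap.range d₁).liftQ d₀ (LinearMap.exact_iff.1 h).ge with he
  have hd₁ : Exact d₁ (LinearMap.range d₁).mkQ := by
    rw [LinearMap.exact_iff, Submodule.ker_mkQ]
  have hN := lTensor_exact N hd₁ (Submodule.mkQ_surjective _)
  have hcomp : ∀ x, e.lTensor N ((LinearMap.range d₁).mkQ.lTensor N x) = d₀.lTensor N x := by
    intro x
    rw [← LinearMap.comp_apply, ← LinearMap.lTensor_comp, he, Submodule.liftQ_mkQ]
  trans Injective (e.lTensor N)
  · constructor
    · intro H
      rw [injective_iff_map_eq_zero]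
      intro y hy
      obtain ⟨x, rfl⟩ := LinearMap.lTensor_surjective N (Submodule.mkQ_surjective _) y
      rw [hcomp, H x] at hy
      exact (hN x).2 hy
    · intro H x
      rw [← hN x, ← hcomp]
      exact map_eq_zero_iff _ H
  · exact ⟨fun H ↦ .of_lTensor_injective (exact_liftQ_mkQ h) (Submodule.mkQ_surjective _) H,
      fun H ↦ H _ _ e _ (liftQ_range_injective h) (exact_liftQ_mkQ h)
        (Submodule.mkQ_surjective _)⟩

end Exactness

section Tor

open CategoryTheory

variable {R : Type u} [CommRing R] {N L F X : Type u} [AddCommGroup N] [Module R N]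
  [AddCommGroup L] [Module R L] [AddCommGroup F] [Module R F] [AddCommGroup X] [Module R X]

theorem ProjectiveResolution.flat_X {X : ModuleCat.{u} R} (P : ProjectiveResolution X) (i : ℕ) :
    Module.Flat R (P.complex.X i) :=
  have := (IsProjective.iff_projective (R := R) (P.complex.X i)).2 (P.projective i)
  inferInstance

theorem ProjectiveResolution.exact_d {X : ModuleCat.{u} R} (P : ProjectiveResolution X) (i : ℕ) :
    Exact (P.complex.d (i + 2) (i + 1)).hom (P.complex.d (i + 1) i).hom :=
  (ShortComplex.ShortExact.moduleCat_exact_iff_function_exact _).1 (P.exact_succ i)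

/-- `Tor_{i+1}(N, X)` is `Tor₁` of `N` with the `i`-th syzygy of `X`. -/
theorem isZero_tor_succ_iff (P : ProjectiveResolution (ModuleCat.of R X)) (i : ℕ) :
    Limits.IsZero (((Tor (ModuleCat.{u} R) (i + 1)).obj (ModuleCat.of R N)).obj
      (ModuleCat.of R X)) ↔
    TorOneVanishes (R := R) N
      (P.complex.X i ⧸ LinearMap.range (P.complex.d (i + 1) i).hom) := by
  have := ProjectiveResolution.flat_X P i
  rw [← lTensor_exact_iff_torOneVanishes (ProjectiveResolution.exact_d P i)]
  rw [Tor_obj, (P.isoLeftDerivedObj _ (i + 1)).isZero_iff]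
  erw [← HomologicalComplex.exactAt_iff_isZero_homology]
  rw [HomologicalComplex.exactAt_iff' _ (i + 2) (i + 1) i (by simp) (by simp)]
  exact ShortComplex.ShortExact.moduleCat_exact_iff_function_exact _

theorem isZero_tor_one_iff :
    Limits.IsZero (((Tor (ModuleCat.{u} R) 1).obj (ModuleCat.of R N)).obj
      (ModuleCat.of R X)) ↔ TorOneVanishes (R := R) N X := by
  let P := projectiveResolution (ModuleCat.of R X)
  have hexact : Exact (P.complex.d 1 0).hom (P.π.f 0).hom :=
    (ShortComplex.ShortExact.moduleCat_exact_iff_function_exact _).1 P.exact₀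
  have hsurj : Surjective (P.π.f 0).hom := (ModuleCat.epi_iff_surjective _).1 inferInstance
  let e : (P.complex.X 0 ⧸ LinearMap.range (P.complex.d 1 0).hom) ≃ₗ[R] X :=
    (Submodule.quotEquivOfEq _ _ (LinearMap.exact_iff.1 hexact).symm).trans
      ((P.π.f 0).hom.quotKerEquivOfSurjective hsurj)
  rw [isZero_tor_succ_iff P]
  exact ⟨.congr e, .congr e.symm⟩

/-- Dimension shifting in the first variable. `Tor` is derived in the second variable, so the syzygy
is moved across by comparing consecutive syzygies of `X`. -/
theorem isZero_tor_succ_succ_iff [Module.Flat R F] {j : L →ₗ[R] F} {q : F →ₗ[R] N}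
    (hj : Injective j) (hjq : Exact j q) (hq : Surjective q) (i : ℕ) :
    Limits.IsZero (((Tor (ModuleCat.{u} R) (i + 2)).obj (ModuleCat.of R N)).obj
      (ModuleCat.of R X)) ↔
    Limits.IsZero (((Tor (ModuleCat.{u} R) (i + 1)).obj (ModuleCat.of R L)).obj
      (ModuleCat.of R X)) := by
  let P := projectiveResolution (ModuleCat.of R X)
  have := ProjectiveResolution.flat_X P i
  rw [isZero_tor_succ_iff P, isZero_tor_succ_iff P]
  exact (TorOneVanishes.syzygy_iff hj hjq hq .of_flat_right .of_flat_right
    (liftQ_range_injective (ProjectiveResolution.exact_d P i))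
    (exact_liftQ_mkQ (ProjectiveResolution.exact_d P i)) (Submodule.mkQ_surjective _)).symm

end Tor

/-! ### Regular sequences and torsion -/

section Depth

open RingTheory.Sequence

/-- The ideal `𝔞` contains a weakly `M`-regular sequence of length `k`. The weak form makes zero
modules harmless; for nonzero finitely generated modules over a local ring and `𝔞 ≠ ⊤` it agrees
with the regular form. -/
def HasWeaklyRegularSeq {R : Type u} [CommRing R] (𝔞 : Ideal R) (k : ℕ) (M : Type v)
    [AddCommGroup M] [Module R M] : Prop :=
  ∃ rs : List R, rs.length = k ∧ (∀ r ∈ rs, r ∈ 𝔞) ∧ IsWeaklyRegular M rs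

variable {R : Type u} [CommRing R] {𝔞 : Ideal R} {M : Type v} [AddCommGroup M] [Module R M]
  {M' : Type w} [AddCommGroup M'] [Module R M']

namespace HasWeaklyRegularSeq

theorem succ_iff {k : ℕ} : HasWeaklyRegularSeq 𝔞 (k + 1) M ↔
    ∃ r ∈ 𝔞, IsSMulRegular M r ∧ HasWeaklyRegularSeq 𝔞 k (QuotSMulTop r M) := by
  constructor
  · rintro ⟨_ | ⟨r, rs⟩, hl, hm, hr⟩
    · simp at hl
    · rw [isWeaklyRegular_cons_iff] at hr
      exact ⟨r, hm r (by simp), hr.1, rs, by simpa using hl, fun s hs ↦ hm s (by simp [hs]), hr.2⟩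
  · rintro ⟨r, hr, hreg, rs, hl, hm, hrs⟩
    exact ⟨r :: rs, by simp [hl], by simpa [hr] using hm, IsWeaklyRegular.cons hreg hrs⟩

theorem mono {k l : ℕ} (hkl : k ≤ l) (h : HasWeaklyRegularSeq 𝔞 l M) :
    HasWeaklyRegularSeq 𝔞 k M := by
  obtain ⟨rs, hl, hm, hr⟩ := h
  refine ⟨rs.take k, by simp [hl, hkl], fun r hr ↦ hm r (List.mem_of_mem_take hr), ?_⟩
  rw [← List.take_append_drop k rs, isWeaklyRegular_append_iff] at hr
  exact hr.1

theorem congr (e : M ≃ₗ[R] M') {k : ℕ} (h : HasWeaklyRegularSeq 𝔞 k M) :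
    HasWeaklyRegularSeq 𝔞 k M' := by
  obtain ⟨rs, hl, hm, hr⟩ := h
  exact ⟨rs, hl, hm, (e.isWeaklyRegular_congr rs).1 hr⟩

/-- Over a local ring, dividing by any `M`-regular element of `𝔞` lowers the length of the regular
sequences in `𝔞` by at most one. This is the Rees characterization of depth by `Ext`. -/
theorem quotSMulTop {M : Type u} [AddCommGroup M] [Module R M] [IsNoetherianRing R]
    [IsLocalRing R] [Module.Finite R M] (h𝔞 : 𝔞 ≠ ⊤) {k : ℕ}
    (h : HasWeaklyRegularSeq 𝔞 (k + 1) M) {r : R} (hr : r ∈ 𝔞) (hreg : IsSMulRegular M r) :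
    HasWeaklyRegularSeq 𝔞 k (QuotSMulTop r M) := by
  rcases subsingleton_or_nontrivial M with hM | hM
  · have : Subsingleton (QuotSMulTop r M) := (Submodule.mkQ_surjective _).subsingleton
    exact ⟨.replicate k r, by simp, fun s hs ↦ List.eq_of_mem_replicate hs ▸ hr,
      ⟨fun i hi _ _ _ ↦ @Subsingleton.elim _ ((Submodule.mkQ_surjective _).subsingleton) _ _⟩⟩
  have h𝔪 := IsLocalRing.le_maximalIdeal h𝔞
  have hlt (T : Type u) [AddCommGroup T] [Module R T] [Module.Finite R T] [Nontrivial T] :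
      𝔞 • (⊤ : Submodule R T) < ⊤ :=
    (Submodule.top_ne_ideal_smul_of_le_jacobson_annihilator
      (h𝔪.trans (IsLocalRing.maximalIdeal_le_jacobson _))).symm.lt_top
  have : Nontrivial (QuotSMulTop r M) := nontrivial_quotSMulTop_of_mem_maximalIdeal M (h𝔪 hr)
  obtain ⟨rs, hl, hm, hrs⟩ := h
  have hext := ((ModuleCat.exists_isRegular_tfae 𝔞 (k + 1) (ModuleCat.of R M) (hlt M)).out
    1 3 rfl rfl).2 ⟨rs, hl, hm, (IsLocalRing.isRegular_iff_isWeaklyRegular_of_subset_maximalIdeal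
      fun s hs ↦ h𝔪 (hm s hs)).2 hrs⟩
  obtain ⟨ts, htl, htm, hts⟩ :=
    ((ModuleCat.exists_isRegular_tfae 𝔞 k (ModuleCat.of R (QuotSMulTop r M)) (hlt _)).out
      1 3 rfl rfl).1 (by
      intro i hi
      have zero1 := AddCommGrpCat.isZero_of_iff_subsingleton.mpr (hext i (by omega))
      have zero2 := AddCommGrpCat.isZero_of_iff_subsingleton.mpr (hext (i + 1) (by omega))
      exact AddCommGrpCat.subsingleton_of_isZero <|
        CategoryTheory.ShortComplex.Exact.isZero_of_both_zeros
        ((CategoryTheory.Abelian.Ext.covariant_sequence_exact₃' _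
          (IsSMulRegular.smulShortComplex_shortExact (M := ModuleCat.of R M) hreg)) i (i + 1) rfl)
        (zero1.eq_zero_of_src _) (zero2.eq_zero_of_tgt _))
  exact ⟨ts, htl, htm, hts.toIsWeaklyRegular⟩

end HasWeaklyRegularSeq

theorem exists_isSMulRegular_of_forall_eq_zero [IsNoetherianRing R] [Module.Finite R M]
    (h : ∀ x : M, (∀ r ∈ 𝔞, r • x = 0) → x = 0) : ∃ r ∈ 𝔞, IsSMulRegular M r := by
  have : Subsingleton ((R ⧸ 𝔞) →ₗ[R] M) := by
    refine subsingleton_of_forall_eq 0 fun f ↦ Submodule.linearMap_qext _ ?_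
    ext
    refine h _ fun r hr ↦ ?_
    rw [← map_smul]
    have : r • Submodule.mkQ 𝔞 1 = 0 := by
      rw [← map_smul, smul_eq_mul, mul_one]
      exact (Submodule.Quotient.mk_eq_zero 𝔞).2 hr
    exact (congrArg f this).trans f.map_zero
  obtain ⟨r, hr, hreg⟩ := IsSMulRegular.subsingleton_linearMap_iff.1 this
  exact ⟨r, by simpa [Ideal.annihilator_quotient] using hr, hreg⟩

/-- A general element of a high power of `𝔞` detects `𝔞`-power torsion: its kernel is
`H⁰_𝔞(M)`. -/
theorem exists_smul_eq_zero_iff_torsion [IsNoetherianRing R] [Module.Finite R M] (𝔞 : Ideal R) :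
    ∃ v ∈ 𝔞, ∀ x : M, v • x = 0 ↔ ∃ k : ℕ, ∀ r ∈ 𝔞 ^ k, r • x = 0 := by
  -- the `𝔞`-power torsion submodule
  let Γ : Submodule R M :=
    { carrier := {x | ∃ k : ℕ, ∀ r ∈ 𝔞 ^ k, r • x = 0}
      zero_mem' := ⟨0, by simp⟩
      add_mem' := by
        rintro x y ⟨k, hk⟩ ⟨l, hl⟩
        exact ⟨k + l, fun r hr ↦ by
          rw [smul_add, hk r (Ideal.pow_le_pow_right (by omega) hr),
            hl r (Ideal.pow_le_pow_right (by omega) hr), add_zero]⟩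
      smul_mem' := by
        rintro c x ⟨k, hk⟩
        exact ⟨k, fun r hr ↦ by rw [smul_comm, hk r hr, smul_zero]⟩ }
  have hmem (x : M) : x ∈ Γ ↔ ∃ k : ℕ, ∀ r ∈ 𝔞 ^ k, r • x = 0 := Iff.rfl
  -- one power of `𝔞` kills the finitely generated module `Γ`
  obtain ⟨l, hl⟩ : ∃ l : ℕ, ∀ x ∈ Γ, ∀ r ∈ 𝔞 ^ l, r • x = 0 := by
    obtain ⟨s, hs⟩ := (IsNoetherian.noetherian Γ : Γ.FG)
    have hsΓ : ∀ x ∈ s, x ∈ Γ := fun x hx ↦ hs ▸ Submodule.subset_span hx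
    choose! k hk using fun x hx ↦ (hmem x).1 (hsΓ x hx)
    refine ⟨s.sup k, fun x hx r hr ↦ ?_⟩
    rw [← hs] at hx
    induction hx using Submodule.span_induction with
    | mem x hx => exact hk x hx r (Ideal.pow_le_pow_right (Finset.le_sup hx) hr)
    | zero => simp
    | add x y _ _ hx hy => rw [smul_add, hx, hy, add_zero]
    | smul c x _ hx => rw [smul_comm, hx, smul_zero]
  -- `M ⧸ Γ` has no `𝔞`-torsion, so `𝔞` contains a regular element `w`
  obtain ⟨w, hw, hreg⟩ : ∃ w ∈ 𝔞, IsSMulRegular (M ⧸ Γ) w := by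
    refine exists_isSMulRegular_of_forall_eq_zero fun y hy ↦ ?_
    obtain ⟨x, rfl⟩ := Submodule.mkQ_surjective _ y
    rw [Submodule.mkQ_apply, Submodule.Quotient.mk_eq_zero]
    refine ⟨l + 1, fun r hr ↦ ?_⟩
    rw [pow_succ] at hr
    induction hr using Submodule.mul_induction_on' with
    | mem_mul_mem a ha b hb =>
      rw [mul_smul]
      have := hy b hb
      rw [← map_smul, Submodule.mkQ_apply, Submodule.Quotient.mk_eq_zero] at this
      exact hl _ this a ha
    | add a _ b _ ha hb => rw [add_smul, ha, hb, add_zero]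
  refine ⟨w ^ (l + 1), Ideal.pow_mem_of_mem _ hw _ (by omega), fun x ↦ ⟨fun hx ↦ ?_, fun hx ↦ ?_⟩⟩
  · exact mem_of_isSMulRegular_quotient_of_smul_mem (hreg.pow (l + 1)) (hx ▸ Γ.zero_mem)
  · exact hl x hx _ (Ideal.pow_le_pow_right (by omega) (Ideal.pow_mem_pow hw _))

/-- Elementary form of the surjectivity of `H⁰(F) → H⁰(N)` for `0 → K → F → N → 0` with `K` of
depth at least two: a lift can be chosen to have the same annihilator. -/
theorem exists_lift_annihilator {K F N : Type*} [AddCommGroup K] [Module R K] [AddCommGroup F]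
    [Module R F] [AddCommGroup N] [Module R N] {j : K →ₗ[R] F} {q : F →ₗ[R] N}
    (hj : Injective j) (hjq : Exact j q) (hq : Surjective q) {r s : R} (hr : IsSMulRegular K r)
    (hs : IsSMulRegular (QuotSMulTop r K) s) {y : N} (hry : r • y = 0) (hsy : s • y = 0) :
    ∃ f : F, q f = y ∧ ∀ b : R, b • y = 0 → b • f = 0 := by
  obtain ⟨f, rfl⟩ := hq y
  obtain ⟨m, hm⟩ := (hjq _).1 ((map_smul q r f).trans hry)
  obtain ⟨m', hm'⟩ := (hjq _).1 ((map_smul q s f).trans hsy)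
  have hsm : s • m = r • m' := hj (by rw [map_smul, map_smul, hm, hm', smul_comm])
  obtain ⟨p, -, hp⟩ := (Submodule.mem_smul_pointwise_iff_exists _ _ _).1
    (mem_of_isSMulRegular_quotient_of_smul_mem hs (hsm ▸
      Submodule.smul_mem_pointwise_smul m' r ⊤ trivial))
  have hqp : q (f - j p) = q f := by rw [map_sub, hjq.apply_apply_eq_zero, sub_zero]
  refine ⟨f - j p, hqp, fun b hb ↦ ?_⟩
  obtain ⟨z, hz⟩ := (hjq (b • (f - j p))).1 (by rw [map_smul, hqp, hb])
  have : r • z = 0 := hj (by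
    rw [map_smul, hz, smul_comm, smul_sub, ← map_smul, hp, hm, sub_self, smul_zero, map_zero])
  rw [← hz, hr.right_eq_zero_of_smul this, map_zero]

end Depth

/-! ### Regular sequences on a syzygy and on the ring -/

section Rigid

variable {R : Type u} [CommRing R]

theorem nontrivial_tensorProduct_of_isLocalRing [IsLocalRing R] (M N : Type*) [AddCommGroup M]
    [Module R M] [AddCommGroup N] [Module R N] [Module.Finite R M] [Module.Finite R N]
    [Nontrivial M] [Nontrivial N] : Nontrivial (M ⊗[R] N) := by
  let k := IsLocalRing.ResidueField R
  have hM : Nontrivial (k ⊗[R] M) := by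
    rwa [← not_subsingleton_iff_nontrivial, IsLocalRing.subsingleton_tensorProduct,
      not_subsingleton_iff_nontrivial]
  have hN : Nontrivial (k ⊗[R] N) := by
    rwa [← not_subsingleton_iff_nontrivial, IsLocalRing.subsingleton_tensorProduct,
      not_subsingleton_iff_nontrivial]
  have : Nontrivial ((k ⊗[R] M) ⊗[k] (k ⊗[R] N)) := by
    rwa [← not_subsingleton_iff_nontrivial,
      Module.FaithfullyFlat.subsingleton_tensorProduct_iff_right, not_subsingleton_iff_nontrivial]
  have := (TensorProduct.AlgebraTensorModule.distribBaseChange R k M N).toEquiv.nontrivial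
  rwa [← not_subsingleton_iff_nontrivial, IsLocalRing.subsingleton_tensorProduct,
    not_subsingleton_iff_nontrivial] at this

theorem lTensor_lsmul_apply {M N : Type*} [AddCommGroup M] [Module R M] [AddCommGroup N]
    [Module R N] (r : R) (x : M ⊗[R] N) : (LinearMap.lsmul R N r).lTensor M x = r • x :=
  LinearMap.congr_fun (LinearMap.lTensor_smul_action M N r) x

variable {N K L F G : Type u} [AddCommGroup N] [Module R N] [AddCommGroup K] [Module R K]
  [AddCommGroup L] [Module R L] [AddCommGroup F] [Module R F] [AddCommGroup G] [Module R G]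
  [Module.Flat R F] [Module.Flat R G]
  {j : K →ₗ[R] F} {q : F →ₗ[R] N} {j' : L →ₗ[R] G} {q' : G →ₗ[R] K}

/-- The step where rigidity is used: if the syzygy `K` of `N` has depth at least two along `A`, then
`A` has positive depth. The module `L` is a second syzygy of `N`, and `hrigid` is rigidity of `N`
from degrees one and two to degree three. -/
theorem hasWeaklyRegularSeq_one_of_two [IsNoetherianRing R] [IsLocalRing R] {𝔞 : Ideal R}
    (h𝔞 : 𝔞 ≠ ⊤) [Module.Finite R F] [Module.Finite R N] [Nontrivial K]
    (hj : Injective j) (hjq : Exact j q) (hq : Surjective q)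
    (hj' : Injective j') (hjq' : Exact j' q') (hq' : Surjective q')
    (hrigid : ∀ (X : Type u) [AddCommGroup X] [Module R X] [Module.Finite R X],
      TorOneVanishes (R := R) N X → TorOneVanishes (R := R) K X → TorOneVanishes (R := R) L X)
    {A : Type u} [AddCommGroup A] [Module R A] [Module.Finite R A]
    (hN : TorOneVanishes (R := R) N A) (hK : TorOneVanishes (R := R) K A)
    (hL : TorOneVanishes (R := R) L A) (h : HasWeaklyRegularSeq 𝔞 2 (K ⊗[R] A)) :
    HasWeaklyRegularSeq 𝔞 1 A := by
  have : Module.Finite R K := Module.Finite.of_injective j hj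
  have hjA : Injective (j.rTensor A) := hN.rTensor_injective hj hjq hq
  have hjqA : Exact (j.rTensor A) (q.rTensor A) := rTensor_exact A hjq hq
  have hqA : Surjective (q.rTensor A) := q.rTensor_surjective A hq
  obtain ⟨r, hr, hrreg, -⟩ := HasWeaklyRegularSeq.succ_iff.1 h
  obtain ⟨v, hv, htors⟩ :=
    exists_smul_eq_zero_iff_torsion (R := R) (M := A × (F ⊗[R] A) × (N ⊗[R] A)) 𝔞
  have hvF (x : F ⊗[R] A) : v • x = 0 ↔ ∃ k : ℕ, ∀ r ∈ 𝔞 ^ k, r • x = 0 := by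
    simpa using htors (0, x, 0)
  have hvN (x : N ⊗[R] A) : v • x = 0 ↔ ∃ k : ℕ, ∀ r ∈ 𝔞 ^ k, r • x = 0 := by
    simpa using htors (0, 0, x)
  have hvK (x : K ⊗[R] A) (hx : v • x = 0) : x = 0 := by
    obtain ⟨k, hk⟩ := (hvF (j.rTensor A x)).1 (by rw [← map_smul, hx, map_zero])
    refine (hrreg.pow k).right_eq_zero_of_smul (hjA ?_)
    rw [map_smul, hk _ (Ideal.pow_mem_pow hr k), map_zero]
  -- `v`-torsion of `N ⊗ A` lifts to `v`-torsion of `F ⊗ A`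
  have hlift (y : N ⊗[R] A) (hy : v • y = 0) :
      ∃ f : F ⊗[R] A, q.rTensor A f = y ∧ v • f = 0 := by
    obtain ⟨k, hk⟩ := (hvN y).1 hy
    have hk' : ∀ b ∈ 𝔞, b ^ (k + 1) • y = 0 := fun b hb ↦
      hk _ (Ideal.pow_le_pow_right (by omega) (Ideal.pow_mem_pow hb (k + 1)))
    obtain ⟨s, hs, hsreg, -⟩ := HasWeaklyRegularSeq.succ_iff.1
      (h.quotSMulTop h𝔞 (Ideal.pow_mem_of_mem _ hr (k + 1) (by omega)) (hrreg.pow (k + 1)))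
    obtain ⟨f, rfl, hf⟩ := exists_lift_annihilator hjA hjqA hqA (hrreg.pow (k + 1))
      (hsreg.pow (k + 1)) (hk' r hr) (hk' s hs)
    exact ⟨f, rfl, hf v hy⟩
  -- the exact sequences `0 → Γ → A → V → 0` and `0 → V → A → A ⧸ V → 0`
  let φ : A →ₗ[R] A := LinearMap.lsmul R A v
  let Γ := LinearMap.ker φ
  let V := LinearMap.range φ
  have hΓ : Injective Γ.subtype := Γ.subtype_injective
  have hV : Injective V.subtype := V.subtype_injective
  have hp : Surjective φ.rangeRestrict := φ.surjective_rangeRestrict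
  have hΓV : Exact Γ.subtype φ.rangeRestrict := fun x ↦ by
    simp [Γ, Subtype.ext_iff]
  have hVX : Exact V.subtype V.mkQ := LinearMap.exact_subtype_mkQ V
  have hΓA : Exact Γ.subtype φ := LinearMap.exact_subtype_ker_map φ
  -- `v` kills `T ⊗ Γ`
  have hvΓ (T : Type u) [AddCommGroup T] [Module R T] (x : T ⊗[R] Γ) : v • x = 0 := by
    induction x with
    | zero => simp
    | add x y hx hy => rw [smul_add, hx, hy, add_zero]
    | tmul t g =>
      rw [← TensorProduct.tmul_smul, show v • g = 0 from Subtype.ext g.2, TensorProduct.tmul_zero]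
  have hFΓ : Injective (Γ.subtype.lTensor F) :=
    Module.Flat.lTensor_preserves_injective_linearMap _ hΓ
  have hcomm (T T' : Type u) [AddCommGroup T] [Module R T] [AddCommGroup T'] [Module R T']
      (a : T →ₗ[R] T') (B B' : Type u) [AddCommGroup B] [Module R B] [AddCommGroup B'] [Module R B']
      (b : B →ₗ[R] B') (x : T ⊗[R] B) :
      a.rTensor B' (b.lTensor T x) = b.lTensor T' (a.rTensor B x) := by
    rw [← LinearMap.comp_apply, ← LinearMap.comp_apply, LinearMap.rTensor_comp_lTensor,
      LinearMap.lTensor_comp_rTensor]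
  -- a lift to `F ⊗ Γ` comes from an element of `K ⊗ A` killed by `v`
  have hNΓ : Injective (Γ.subtype.lTensor N) := by
    rw [injective_iff_map_eq_zero]
    intro z hz
    obtain ⟨z, rfl⟩ := q.rTensor_surjective Γ hq z
    rw [← hcomm] at hz
    obtain ⟨w, hw⟩ := (hjqA _).1 hz
    have hw0 : w = 0 := hvK w (hjA (by rw [map_smul, hw, ← map_smul, hvΓ, map_zero, map_zero]))
    have : z = 0 := hFΓ (by rw [← hw, hw0, map_zero, map_zero])
    rw [this, map_zero]
  -- torsion of `N ⊗ A` comes from `F ⊗ Γ`, hence vanishes in `N ⊗ V`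
  have hNV : Injective (V.subtype.lTensor N) := by
    rw [injective_iff_map_eq_zero]
    intro z hz
    obtain ⟨y, rfl⟩ := φ.rangeRestrict.lTensor_surjective N hp z
    have hy : v • y = 0 := by
      rw [← lTensor_lsmul_apply, ← hz, ← LinearMap.comp_apply, ← LinearMap.lTensor_comp]
      rfl
    obtain ⟨f, rfl, hf⟩ := hlift y hy
    have hflat := Module.Flat.lTensor_exact F hΓA
    obtain ⟨g, rfl⟩ := (hflat f).1 ((lTensor_lsmul_apply v f).trans hf)
    rw [← hcomm, ← LinearMap.comp_apply (φ.rangeRestrict.lTensor F), ← LinearMap.lTensor_comp,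
      hΓV.linearMap_comp_eq_zero]
    simp
  have h₁ : TorOneVanishes (R := R) N (A ⧸ V) :=
    hN.of_shortExact hVX V.mkQ_surjective hNV
  have h₂ : TorOneVanishes (R := R) K (A ⧸ V) :=
    (hN.syzygy_iff hj hjq hq hK hV hVX V.mkQ_surjective).2 (hN.of_shortExact hΓV hp hNΓ)
  have h₃ : TorOneVanishes (R := R) L (A ⧸ V) := hrigid _ h₁ h₂
  have h₄ : TorOneVanishes (R := R) N Γ :=
    (hN.syzygy_iff hj hjq hq hK hΓ hΓV hp).1
      ((hK.syzygy_iff hj' hjq' hq' hL hV hVX V.mkQ_surjective).1 h₃)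
  have hKΓ : Subsingleton (K ⊗[R] Γ) := by
    refine subsingleton_of_forall_eq 0 fun x ↦ h₄.rTensor_injective hj hjq hq (hFΓ ?_)
    have : Γ.subtype.lTensor K x = 0 := hvK _ (by rw [← map_smul, hvΓ, map_zero])
    rw [← hcomm, this, map_zero, map_zero, map_zero]
  have hΓ0 : Γ = ⊥ := by
    by_contra hne
    have : Nontrivial Γ := Submodule.nontrivial_iff_ne_bot.2 hne
    exact not_subsingleton_iff_nontrivial.2 (nontrivial_tensorProduct_of_isLocalRing K Γ) hKΓ
  exact HasWeaklyRegularSeq.succ_iff.2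
    ⟨v, hv, LinearMap.ker_eq_bot.1 hΓ0, [], rfl, by simp, .nil _ _⟩

/-- The depth of `A` is at least that of `K ⊗ A` minus one, for a first syzygy `K` of a rigid module
`N` that is Tor-independent of `A` in degrees one to three. -/
theorem hasWeaklyRegularSeq_of_syzygy [IsNoetherianRing R] [IsLocalRing R] {𝔞 : Ideal R}
    (h𝔞 : 𝔞 ≠ ⊤) [Module.Finite R F] [Module.Finite R N] [Nontrivial K]
    (hj : Injective j) (hjq : Exact j q) (hq : Surjective q)
    (hj' : Injective j') (hjq' : Exact j' q') (hq' : Surjective q')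
    (hrigid : ∀ (X : Type u) [AddCommGroup X] [Module R X] [Module.Finite R X],
      TorOneVanishes (R := R) N X → TorOneVanishes (R := R) K X → TorOneVanishes (R := R) L X)
    (n : ℕ) {A : Type u} [AddCommGroup A] [Module R A] [Module.Finite R A]
    (hN : TorOneVanishes (R := R) N A) (hK : TorOneVanishes (R := R) K A)
    (hL : TorOneVanishes (R := R) L A) (h : HasWeaklyRegularSeq 𝔞 (n + 2) (K ⊗[R] A)) :
    HasWeaklyRegularSeq 𝔞 (n + 1) A := by
  induction n generalizing A with
  | zero => exact hasWeaklyRegularSeq_one_of_two h𝔞 hj hjq hq hj' hjq' hq' hrigid hN hK hL h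
  | succ n ih =>
    have : Module.Finite R K := Module.Finite.of_injective j hj
    have hA : HasWeaklyRegularSeq 𝔞 1 A := (ih hN hK hL (h.mono (by omega))).mono (by omega)
    obtain ⟨t, ht, htreg, -⟩ := HasWeaklyRegularSeq.succ_iff.1 hA
    obtain ⟨r, hr, hrreg, hr'⟩ := HasWeaklyRegularSeq.succ_iff.1 h
    obtain ⟨s, hs, hsreg, -⟩ := HasWeaklyRegularSeq.succ_iff.1 hr'
    -- an element of `𝔞` regular on `A`, `N ⊗ A` and `K ⊗ A` at once
    obtain ⟨x, hx, hxreg⟩ := exists_isSMulRegular_of_forall_eq_zero (𝔞 := 𝔞)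
      (M := A × (N ⊗[R] A) × (K ⊗[R] A)) (by
      rintro ⟨a, y, z⟩ hayz
      simp only [Prod.smul_mk, Prod.mk_eq_zero] at hayz ⊢
      refine ⟨htreg.right_eq_zero_of_smul (hayz t ht).1, ?_,
        hrreg.right_eq_zero_of_smul (hayz r hr).2.2⟩
      obtain ⟨f, rfl, hf⟩ := exists_lift_annihilator (hN.rTensor_injective hj hjq hq)
        (rTensor_exact A hjq hq) (q.rTensor_surjective A hq) hrreg hsreg (hayz r hr).2.1
        (hayz s hs).2.1
      rw [(htreg.lTensor (M := F)).right_eq_zero_of_smul (hf t (hayz t ht).2.1), map_zero])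
    have hxA : IsSMulRegular A x := .of_right_eq_zero_of_smul fun a ha ↦ by
      simpa using hxreg.right_eq_zero_of_smul (x := (a, 0, 0)) (by simp [ha])
    have hxN : IsSMulRegular (N ⊗[R] A) x := .of_right_eq_zero_of_smul fun a ha ↦ by
      simpa using hxreg.right_eq_zero_of_smul (x := (0, a, 0)) (by simp [ha])
    have hxK : IsSMulRegular (K ⊗[R] A) x := .of_right_eq_zero_of_smul fun a ha ↦ by
      simpa using hxreg.right_eq_zero_of_smul (x := (0, 0, a)) (by simp [ha])
    have hxL : IsSMulRegular (L ⊗[R] A) x :=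
      (hxA.lTensor (M := G)).of_injective (j'.rTensor A) (hK.rTensor_injective hj' hjq' hq')
    have hex := LinearMap.exact_lsmul_mkQ_smul_top A x
    have hquot {T : Type u} [AddCommGroup T] [Module R T] (hT : TorOneVanishes (R := R) T A)
        (hxT : IsSMulRegular (T ⊗[R] A) x) : TorOneVanishes (R := R) T (QuotSMulTop x A) := by
      refine hT.of_shortExact hex (Submodule.mkQ_surjective _) ?_
      intro y z hyz
      exact hxT ((lTensor_lsmul_apply x y).symm.trans (hyz.trans (lTensor_lsmul_apply x z)))
    exact HasWeaklyRegularSeq.succ_iff.2 ⟨x, hx, hxA, ih (hquot hN hxN) (hquot hK hxK)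
      (hquot hL hxL) ((h.quotSMulTop h𝔞 hx hxK).congr
        (QuotSMulTop.tensorQuotSMulTopEquivQuotSMulTop x K A).symm)⟩

end Rigid

/-! ### The depth bound and generic freeness over reduced rings -/

section Main

open RingTheory.Sequence

variable {R : Type u} [CommRing R]

theorem le_idealDepth {𝔞 : Ideal R} {M : Type v} [AddCommGroup M] [Module R M] {rs : List R}
    (hrs : ∀ r ∈ rs, r ∈ 𝔞) (hreg : IsRegular M rs) : (rs.length : ℕ∞) ≤ idealDepth 𝔞 M := by
  unfold idealDepth
  split_ifs
  · exact le_top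
  · exact le_iSup₂_of_le rs ⟨hrs, hreg⟩ le_rfl

theorem HasWeaklyRegularSeq.of_lt_idealDepth {𝔞 : Ideal R} {M : Type v} [AddCommGroup M]
    [Module R M] (hM : 𝔞 • (⊤ : Submodule R M) ≠ ⊤) {n : ℕ} (h : (n : ℕ∞) < idealDepth 𝔞 M) :
    HasWeaklyRegularSeq 𝔞 (n + 1) M := by
  rw [idealDepth, if_neg hM] at h
  simp only [lt_iSup_iff] at h
  obtain ⟨rs, ⟨hrs, hreg⟩, hlt⟩ := h
  exact HasWeaklyRegularSeq.mono (Nat.cast_lt.1 hlt) ⟨rs, rfl, hrs, hreg.toIsWeaklyRegular⟩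

/-- `2`-Tor-rigidity from `Tor₁` and `Tor₂` to `Tor₃`, written in terms of the syzygies `K` and `L`
of `N`. -/
theorem IsTorRigid.torOneVanishes {N K L F G : Type u} [AddCommGroup N] [Module R N]
    [AddCommGroup K] [Module R K] [AddCommGroup L] [Module R L] [AddCommGroup F] [Module R F]
    [AddCommGroup G] [Module R G] [Module.Flat R F] [Module.Flat R G]
    {j : K →ₗ[R] F} {q : F →ₗ[R] N} {j' : L →ₗ[R] G} {q' : G →ₗ[R] K}
    (hj : Injective j) (hjq : Exact j q) (hq : Surjective q)
    (hj' : Injective j') (hjq' : Exact j' q') (hq' : Surjective q')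
    (h : IsTorRigid R 2 N) (X : Type u) [AddCommGroup X] [Module R X] [Module.Finite R X]
    (h₁ : TorOneVanishes (R := R) N X) (h₂ : TorOneVanishes (R := R) K X) :
    TorOneVanishes (R := R) L X := by
  have h₃ := h X 0 (fun i hi hi' ↦ by
    obtain rfl | rfl : i = 1 ∨ i = 2 := by omega
    · exact isZero_tor_one_iff.2 h₁
    · exact (isZero_tor_succ_succ_iff hj hjq hq 0).2 (isZero_tor_one_iff.2 h₂)) 3 (by omega)
  rw [isZero_tor_succ_succ_iff hj hjq hq 1, isZero_tor_succ_succ_iff hj' hjq' hq' 0] at h₃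
  exact isZero_tor_one_iff.1 h₃

theorem idealDepth_firstSyzygy_le [IsNoetherianRing R] [IsLocalRing R] (𝔞 : Ideal R)
    {N : Type u} [AddCommGroup N] [Module R N] [Module.Finite R N] (hN : IsTorRigid R 2 N)
    {M : Type v} [AddCommGroup M] [Module R M] (hM : IsFirstSyzygy R N M) [Nontrivial M] :
    idealDepth 𝔞 M ≤ idealDepth 𝔞 R + 1 := by
  obtain ⟨m, q, hq, -, ⟨e⟩⟩ := hM
  by_contra! hlt
  have hfin : idealDepth 𝔞 R ≠ ⊤ := by
    intro htop
    simp [htop] at hlt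
  obtain ⟨n, hn⟩ := ENat.ne_top_iff_exists.1 hfin
  have h𝔞 : 𝔞 ≠ ⊤ := by
    rintro rfl
    exact hfin (by simp [idealDepth])
  have h𝔪 := IsLocalRing.le_maximalIdeal h𝔞
  have : Module.Finite R M := .equiv e.symm
  have hMtop : 𝔞 • (⊤ : Submodule R M) ≠ ⊤ :=
    (Submodule.top_ne_ideal_smul_of_le_jacobson_annihilator
      (h𝔪.trans (IsLocalRing.maximalIdeal_le_jacobson _))).symm
  have hseq : HasWeaklyRegularSeq 𝔞 (n + 2) M :=
    .of_lt_idealDepth (n := n + 1) hMtop (by rw [← hn] at hlt; exact_mod_cast hlt)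
  have hK : Nontrivial (LinearMap.ker q) := e.symm.toEquiv.nontrivial
  obtain ⟨L, G, _, _, _, _, j', q', _, hj', hjq', hq'⟩ :=
    exists_flat_presentation R (LinearMap.ker q)
  have hj := (LinearMap.ker q).subtype_injective
  have hjq := LinearMap.exact_subtype_ker_map q
  obtain ⟨rs, hl, hrs, hreg⟩ := hasWeaklyRegularSeq_of_syzygy h𝔞 hj hjq hq hj' hjq' hq'
    (hN.torOneVanishes hj hjq hq hj' hjq' hq') n (A := R) .of_flat_right .of_flat_right
    .of_flat_right (hseq.congr (e.trans (TensorProduct.rid R _).symm))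
  have hle := le_idealDepth hrs
    ((IsLocalRing.isRegular_iff_isWeaklyRegular_of_subset_maximalIdeal
      fun s hs ↦ h𝔪 (hrs s hs)).2 hreg)
  rw [← hn, hl, Nat.cast_le] at hle
  omega

theorem isGenericallyFree_of_isReduced [IsReduced R] (N : Type v) [AddCommGroup N] [Module R N] :
    IsGenericallyFree R N := by
  intro 𝔭 _ h𝔭
  obtain ⟨-, x, hx⟩ := h𝔭
  -- as `R` is reduced, the radical of the annihilator of `x` is the annihilator itself
  have hmem (a : R) : a ∈ 𝔭 ↔ a * x = 0 := by
    rw [hx, Ideal.mem_radical_iff]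
    simp only [Submodule.mem_colon_singleton, smul_eq_mul, Submodule.mem_bot]
    refine ⟨fun ⟨k, hk⟩ ↦ eq_zero_of_pow_eq_zero (n := k + 1) ?_, fun h ↦ ⟨1, by simpa using h⟩⟩
    rw [mul_pow, pow_succ' x, pow_succ' a, mul_assoc, ← mul_assoc (a ^ k), hk, zero_mul, mul_zero]
  have hx𝔭 : x ∉ 𝔭 := fun h ↦ by
    have : x = 0 := IsReduced.eq_zero x ⟨2, by simpa [sq] using (hmem x).1 h⟩
    exact Ideal.IsPrime.one_notMem ‹_› ((hmem 1).2 (by simp [this]))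
  have hfield : IsField (Localization.AtPrime 𝔭) := by
    rw [IsLocalRing.isField_iff_maximalIdeal_eq, ← Localization.AtPrime.map_eq_maximalIdeal,
      Ideal.map_eq_bot_iff_le_ker]
    intro a ha
    exact (IsLocalization.map_eq_zero_iff 𝔭.primeCompl _ a).2
      ⟨⟨x, hx𝔭⟩, by simpa [mul_comm] using (hmem a).1 ha⟩
  let := hfield.toField
  exact Module.Free.of_divisionRing (Localization.AtPrime 𝔭) (LocalizedModule.AtPrime 𝔭 N)

end Main

theorem corollary3p4 (R : Type u) [CommRing R] [IsNoetherianRing R] [IsLocalRing R] :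
    (∀ (𝔞 : Ideal R), 1 ≤ idealDepth 𝔞 R →
      ∀ (N : Type u) [AddCommGroup N] [Module R N] [Module.Finite R N],
        IsTorRigid R 2 N → IsGenericallyFree R N →
        ∀ (M : Type v) [AddCommGroup M] [Module R M], IsFirstSyzygy R N M → Nontrivial M →
          idealDepth 𝔞 M ≤ idealDepth 𝔞 R + 1) ∧
    (IsReduced R → ∀ (N : Type u) [AddCommGroup N] [Module R N] [Module.Finite R N],
      IsGenericallyFree R N) :=
  ⟨fun 𝔞 _ _ _ _ _ hN _ _ _ _ hM _ ↦ idealDepth_firstSyzygy_le 𝔞 hN hM,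
    fun _ N _ _ _ ↦ isGenericallyFree_of_isReduced N⟩
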